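/- Let $(A,\mathfrak m)$ be an equicharacteristic Artinian local ring and let $x_1,\dots,x_n\in\mathfrak m$. For a finitely generated module $M$ let $\nu(M)$ denote its least number of generators. For a local ring $B\cong T/I$ with $T$ a regular local ring, let $\operatorname{cid}(B)=\nu(I)-\operatorname{ht}(I)$ denote the complete intersection defect of $B$ (it does not depend on the choice of $T$ and $I$). If $$\operatorname{cid}(A)\ \ge\ \operatorname{cid}\bigl(A/(x_1,\dots,x_n)A\bigr),$$ then the first Koszul homology module $H_1(x_1,\dots,x_n;A)$ needs at least $n$ generators, that is, $\nu\bigl(H_1(x_1,\dots,x_n;A)\bigr)\ge n$. -/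

import Mathlib

noncomputable section

namespace Koszul

variable {A : Type*} [CommRing A] {n : ℕ}

/-- The Koszul differential of the sequence `x 0, …, x (n - 1)`, on the exterior algebra of the free
module `Aⁿ` with standard basis `u 0, …, u (n - 1)`: the contraction with the linear form
`u j ↦ x j`, that is,
`u_{j_1} ∧ ⋯ ∧ u_{j_i} ↦ ∑ t, (-1)^(t-1) x_{j_t} u_{j_1} ∧ ⋯ (omit u_{j_t}) ⋯ ∧ u_{j_i}`. -/
def differential (x : Fin n → A) :
    ExteriorAlgebra A (Fin n → A) →ₗ[A] ExteriorAlgebra A (Fin n → A) :=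
  CliffordAlgebra.contractLeft (Q := (0 : QuadraticForm A (Fin n → A)))
    (Fintype.linearCombination A x)

theorem differential_single (x : Fin n → A) (j : Fin n) :
    differential x (ExteriorAlgebra.ι A (Pi.single j 1)) = algebraMap A _ (x j) := by
  refine (CliffordAlgebra.contractLeft_ι _ (Fintype.linearCombination A x) _).trans ?_
  simp

/-- The differential is a graded derivation. -/
theorem differential_ι_mul (x : Fin n → A) (v : Fin n → A) (w : ExteriorAlgebra A (Fin n → A)) :
    differential x (ExteriorAlgebra.ι A v * w) =
      (∑ j, v j * x j) • w - ExteriorAlgebra.ι A v * differential x w := by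
  refine (CliffordAlgebra.contractLeft_ι_mul _ _ _).trans ?_
  simp [differential, Fintype.linearCombination_apply]

theorem differential_differential (x : Fin n → A) (w : ExteriorAlgebra A (Fin n → A)) :
    differential x (differential x w) = 0 :=
  CliffordAlgebra.contractLeft_contractLeft _ _

theorem differential_mem (x : Fin n → A) (i : ℕ) (w : ExteriorAlgebra A (Fin n → A))
    (hw : w ∈ ⋀[A]^(i + 1) (Fin n → A)) : differential x w ∈ ⋀[A]^i (Fin n → A) := by
  induction i generalizing w with
  | zero =>
    rw [ExteriorAlgebra.exteriorPower, pow_one] at hw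
    obtain ⟨v, rfl⟩ := hw
    rw [ExteriorAlgebra.exteriorPower, pow_zero]
    exact Submodule.mem_one.2
      ⟨_, (CliffordAlgebra.contractLeft_ι _ (Fintype.linearCombination A x) v).symm⟩
  | succ i ih =>
    rw [ExteriorAlgebra.exteriorPower, pow_succ'] at hw
    induction hw using Submodule.mul_induction_on' with
    | mem_mul_mem m hm w hw =>
      obtain ⟨v, rfl⟩ := hm
      rw [differential_ι_mul]
      refine Submodule.sub_mem _ (Submodule.smul_mem _ _ hw) ?_
      rw [ExteriorAlgebra.exteriorPower, pow_succ']
      exact Submodule.mul_mem_mul ⟨v, rfl⟩ (ih w hw)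
    | add a _ b _ ha hb =>
      rw [map_add]
      exact Submodule.add_mem _ ha hb

/-- The cycles of degree `i` of the Koszul complex `K_•(x; A)`, with `K_i(x; A) = ⋀ⁱ Aⁿ`. -/
def cycles (x : Fin n → A) (i : ℕ) : Submodule A (ExteriorAlgebra A (Fin n → A)) :=
  ⋀[A]^i (Fin n → A) ⊓ LinearMap.ker (differential x)

/-- The boundaries of degree `i`: the image of `K_{i+1}(x; A) = ⋀ⁱ⁺¹ Aⁿ`. -/
def boundaries (x : Fin n → A) (i : ℕ) : Submodule A (ExteriorAlgebra A (Fin n → A)) :=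
  (⋀[A]^(i + 1) (Fin n → A)).map (differential x)

theorem boundaries_le_cycles (x : Fin n → A) (i : ℕ) : boundaries x i ≤ cycles x i := by
  rintro _ ⟨w, hw, rfl⟩
  exact ⟨differential_mem x i w hw, differential_differential x w⟩

/-- The Koszul homology module `H_i(x 0, …, x (n - 1); A)`: cycles modulo boundaries. -/
abbrev homology (x : Fin n → A) (i : ℕ) : Type _ :=
  cycles x i ⧸ (boundaries x i).submoduleOf (cycles x i)

end Koszul

/-- The least number of generators `ν(M)` of a finitely generated module `M`. -/
def minGenerators (A M : Type*) [CommRing A] [AddCommGroup M] [Module A M] : ℕ :=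
  (⊤ : Submodule A M).spanFinrank

universe u in
/-- `IsCid A c`: for some presentation `A ≅ T / I` with `T` a regular local ring, one has
`c = ν(I) - ht(I)`. -/
def IsCid (A : Type u) [CommRing A] (c : ℕ) : Prop :=
  ∃ (T : Type u) (_ : CommRing T) (f : T →+* A),
    IsRegularLocalRing T ∧ Function.Surjective f ∧
      (minGenerators T (RingHom.ker f) : ℕ∞) = (RingHom.ker f).height + c

universe u in
/-- The complete intersection defect `cid(A) = ν(I) - ht(I)` of a local ring `A ≅ T / I` with `T`
regular local. The number does not depend on the presentation, so that the infimum below is taken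
over a set with one element whenever `A` has a presentation. -/
def cid (A : Type u) [CommRing A] : ℕ :=
  sInf {c | IsCid A c}

end

/-!
Let `T → A` be a presentation with kernel `I`, where `T` is regular local, and lift `x` to `T`.
The surjection `I × Tⁿ → I + (x)`, `(i, a) ↦ i + ∑ a j * x j`, has as kernel the vectors `a` with
`∑ a j * x j ∈ I`, that is, the syzygies of `x` in `A`, lifted to `T`. Among these, the ones that
are trivial in `A` land in `𝔪 (I × Tⁿ)`, so that counting generators gives `ν(I) + n ≤ ν(H₁(x; A))
+ ν(I + (x))`; this is `minGenerators_ker_add_le`. As `T → A / (x)` has kernel `I + (x)` and both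
kernels have height `dim T`, the hypothesis on `cid` says `ν(I + (x)) ≤ ν(I)`, and the claim
follows.

Two facts justify the reading of `cid` used here.

* The number `ν(ker f) - dim T` does not depend on the presentation `f : T → B`. A regular system
  of parameters `t` of `T` has only trivial syzygies (`ker_le_trivialSyzygies`), so `ν(ker f)` is
  the number of generators of `H₁(f t; B)` (`minGenerators_ker_eq`). Adjoining to a sequence that
  generates the maximal ideal of `B` one more element of that ideal adds one generator to `H₁`, so
  comparing two generating sequences with their concatenation shows that `ν(H₁)` minus the length
  is the same for both (`minGenerators_syzygyHomology_add_finrank`).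
* A presentation exists (`exists_presentation`). The residue field is formally smooth over its
  prime field, also when it is not finitely generated (`formallySmooth_zmod`,
  `formallySmooth_rat`), so that it lifts to a coefficient field of the Artinian ring `A`. Then
  `A` is a quotient of a localized polynomial ring.

The first Koszul homology is handled in the form `syzygyHomology`: the kernel of a linear form `L
: F → R` modulo the vectors `L u • v - L v • u`.
-/

/-! ### Numbers of generators -/

section MinGenerators

variable {R S T M N Q : Type*} [CommRing R] [CommRing S] [CommRing T]
  [AddCommGroup M] [Module R M] [AddCommGroup N] [Module S N] [AddCommGroup Q] [Module T Q]

/-- If `φ : M → N` and `ψ : M → Q` are surjective and `ψ` factors through `φ`, then `Q` needs at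
most as many generators as `N`. The maps are semilinear, so that generators may be counted over
different rings. -/
theorem minGenerators_le_of_ker_le {f : R →+* S} {g : R →+* T} [RingHomSurjective f]
    [RingHomSurjective g] (φ : M →ₛₗ[f] N) (ψ : M →ₛₗ[g] Q) (hφ : Function.Surjective φ)
    (hψ : Function.Surjective ψ) (h : LinearMap.ker φ ≤ LinearMap.ker ψ) [Module.Finite S N] :
    minGenerators T Q ≤ minGenerators S N := by
  classical
  obtain ⟨s, hs, hspan⟩ :=
    (Module.Finite.fg_top (R := S) (M := N)).exists_span_finset_card_eq_spanFinrank
  choose σ hσ using hφ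
  have key : Submodule.span R (σ '' (s : Set N)) ⊔ LinearMap.ker φ = ⊤ := by
    rw [← Submodule.comap_map_eq, Submodule.map_span, ← Set.image_comp]
    have : (φ ∘ σ) = id := funext hσ
    rw [this, Set.image_id, hspan, Submodule.comap_top]
  have h2 : Submodule.span T (((s.image σ).image ψ : Finset Q) : Set Q) = ⊤ := by
    rw [Finset.coe_image, Finset.coe_image, ← Submodule.map_span]
    refine top_unique ?_
    rw [← LinearMap.range_eq_top.2 hψ, ← Submodule.map_top, ← key, Submodule.map_sup]
    refine sup_le le_rfl ?_
    rintro _ ⟨x, hx, rfl⟩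
    rw [LinearMap.mem_ker.1 (h hx)]
    exact zero_mem _
  unfold minGenerators
  rw [← hs, ← h2]
  refine (Submodule.spanFinrank_span_le_ncard_of_finite (Finset.finite_toSet _)).trans ?_
  rw [Set.ncard_coe_finset]
  exact Finset.card_image_le.trans Finset.card_image_le

theorem minGenerators_le_add (K : Submodule R M) [Module.Finite R K] [Module.Finite R M] :
    minGenerators R M ≤ minGenerators R K + minGenerators R (M ⧸ K) := by
  classical
  obtain ⟨s, hs, hs'⟩ := Submodule.FG.exists_span_finset_card_eq_spanFinrank
    (Module.Finite.iff_fg.1 ‹Module.Finite R K›)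
  obtain ⟨t, ht, ht'⟩ := Submodule.FG.exists_span_finset_card_eq_spanFinrank
    (Module.Finite.fg_top (R := R) (M := M ⧸ K))
  choose σ hσ using K.mkQ_surjective
  have h : Submodule.span R ((s ∪ t.image σ : Finset M) : Set M) = ⊤ := by
    have : (K.mkQ ∘ σ) = id := funext hσ
    have key : Submodule.span R (σ '' (t : Set (M ⧸ K))) ⊔ LinearMap.ker K.mkQ = ⊤ := by
      rw [← Submodule.comap_map_eq, Submodule.map_span, ← Set.image_comp, this, Set.image_id, ht',
        Submodule.comap_top]
    rw [Finset.coe_union, Submodule.span_union, Finset.coe_image, hs', sup_comm]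
    exact (congrArg _ K.ker_mkQ.symm).trans key
  unfold minGenerators
  rw [Submodule.spanFinrank_top, ← hs, ← ht, ← h]
  refine (Submodule.spanFinrank_span_le_ncard_of_finite (Finset.finite_toSet _)).trans ?_
  rw [Set.ncard_coe_finset]
  exact (Finset.card_union_le _ _).trans (Nat.add_le_add_left Finset.card_image_le _)

end MinGenerators

section Local

open IsLocalRing TensorProduct

variable {R S M N Q : Type*} [CommRing R] [CommRing S] [IsLocalRing R]
  [AddCommGroup M] [Module R M] [AddCommGroup N] [Module S N] [AddCommGroup Q] [Module R Q]

theorem minGenerators_eq_finrank [Module.Finite R Q] :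
    minGenerators R Q = Module.finrank (ResidueField R) (ResidueField R ⊗[R] Q) := by
  have e := (TensorProduct.AlgebraTensorModule.congr (LinearEquiv.refl (ResidueField R)
    (ResidueField R)) (Submodule.topEquiv (R := R) (M := Q))).finrank_eq
  rw [← e, Module.finrank_eq_spanFinrank_of_free, minGenerators,
    ← TensorProduct.spanFinrank_top_eq_of_residueField _ Module.Finite.fg_top]

theorem minGenerators_prod [Module.Finite R M] [Module.Finite R Q] :
    minGenerators R (M × Q) = minGenerators R M + minGenerators R Q := by
  rw [minGenerators_eq_finrank, minGenerators_eq_finrank, minGenerators_eq_finrank,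
    (TensorProduct.prodRight R (ResidueField R) (ResidueField R) M Q).finrank_eq,
    Module.finrank_prod]

theorem minGenerators_eq_finrank_of_free [Module.Free R Q] :
    minGenerators R Q = Module.finrank R Q :=
  Module.finrank_eq_spanFinrank_of_free.symm

/-- Nakayama's lemma: a quotient of a finitely generated module `Q` over a local ring by a submodule
of `𝔪 Q` needs at least as many generators as `Q`. -/
theorem minGenerators_le_of_ker_le_smul [Module.Finite R Q] (φ : Q →ₗ[R] M)
    (hφ : Function.Surjective φ)
    (h : LinearMap.ker φ ≤ maximalIdeal R • ⊤) :
    minGenerators R Q ≤ minGenerators R M := by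
  classical
  have : Module.Finite R M := Module.Finite.of_surjective φ hφ
  obtain ⟨s, hs, hspan⟩ :=
    (Module.Finite.fg_top (R := R) (M := M)).exists_span_finset_card_eq_spanFinrank
  choose σ hσ using hφ
  have key : Submodule.span R (σ '' (s : Set M)) ⊔ LinearMap.ker φ = ⊤ := by
    rw [← Submodule.comap_map_eq, Submodule.map_span, ← Set.image_comp]
    have : (φ ∘ σ) = id := funext hσ
    rw [this, Set.image_id, hspan, Submodule.comap_top]
  have h2 : Submodule.span R (σ '' (s : Set M)) = ⊤ := by
    refine top_unique (Submodule.le_of_le_smul_of_le_jacobson_bot Module.Finite.fg_top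
      (maximalIdeal_le_jacobson _) ?_)
    rw [← key]
    exact sup_le_sup_left (by rwa [key]) _
  unfold minGenerators
  rw [← hs, ← h2, ← Finset.coe_image]
  refine (Submodule.spanFinrank_span_le_ncard_of_finite (Finset.finite_toSet _)).trans ?_
  rw [Set.ncard_coe_finset]
  exact Finset.card_image_le

/-- If `M → N` and `M → Q` are surjective, `Q` is finitely generated over a local ring `R`, and
`M → Q / 𝔪 Q` factors through `N`, then `Q` needs at most as many generators as `N`. -/
theorem minGenerators_le_of_ker_le_comap {f : R →+* S} [RingHomSurjective f]
    (φ : M →ₛₗ[f] N) (ψ : M →ₗ[R] Q) (hφ : Function.Surjective φ)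
    (hψ : Function.Surjective ψ) [Module.Finite S N] [Module.Finite R Q]
    (h : LinearMap.ker φ ≤ (maximalIdeal R • (⊤ : Submodule R Q)).comap ψ) :
    minGenerators R Q ≤ minGenerators S N := by
  refine (minGenerators_le_of_ker_le_smul (R := R)
    (maximalIdeal R • (⊤ : Submodule R Q)).mkQ (Submodule.mkQ_surjective _) (by simp)).trans ?_
  refine minGenerators_le_of_ker_le φ ((maximalIdeal R • (⊤ : Submodule R Q)).mkQ ∘ₗ ψ) hφ
    ((Submodule.mkQ_surjective _).comp hψ) ?_
  rwa [LinearMap.ker_comp, Submodule.ker_mkQ]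

end Local

/-! ### The first Koszul homology of a linear form -/

section Syzygies

variable {R F G : Type*} [CommRing R] [AddCommGroup F] [Module R F] [AddCommGroup G] [Module R G]

/-- The trivial syzygies `L u • v - L v • u` of a linear form `L`. If `L` is the form on `Rⁿ` with
values `x 0, …, x (n - 1)`, they form the image of the Koszul differential `⋀² Rⁿ → Rⁿ`. -/
def trivialSyzygies (L : F →ₗ[R] R) : Submodule R F :=
  Submodule.span R {w | ∃ u v, w = L u • v - L v • u}

theorem sub_mem_trivialSyzygies (L : F →ₗ[R] R) (u v : F) :
    L u • v - L v • u ∈ trivialSyzygies L :=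
  Submodule.subset_span ⟨u, v, rfl⟩

theorem trivialSyzygies_le_ker (L : F →ₗ[R] R) : trivialSyzygies L ≤ LinearMap.ker L := by
  refine Submodule.span_le.2 ?_
  rintro _ ⟨u, v, rfl⟩
  simp [mul_comm]

/-- Syzygies modulo trivial syzygies: the first Koszul homology of a linear form, written without
the choice of a basis and without exterior powers. -/
abbrev syzygyHomology (L : F →ₗ[R] R) : Type _ :=
  LinearMap.ker L ⧸ (trivialSyzygies L).submoduleOf (LinearMap.ker L)

theorem boundaries_one_le {n : ℕ} (x : Fin n → R) :
    Koszul.boundaries x 1 ≤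
      (trivialSyzygies (Fintype.linearCombination R x)).map (ExteriorAlgebra.ι R) := by
  rintro _ ⟨w, hw, rfl⟩
  change w ∈ LinearMap.range (ExteriorAlgebra.ι R) ^ 2 at hw
  rw [pow_two] at hw
  induction hw using Submodule.mul_induction_on' with
  | mem_mul_mem m hm w hw =>
    obtain ⟨u, rfl⟩ := hm
    obtain ⟨v, rfl⟩ := hw
    refine ⟨_, sub_mem_trivialSyzygies _ u v, ?_⟩
    rw [Koszul.differential_ι_mul]
    have h : Koszul.differential x (ExteriorAlgebra.ι R v) =
        algebraMap R _ (Fintype.linearCombination R x v) :=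
      CliffordAlgebra.contractLeft_ι _ (Fintype.linearCombination R x) v
    rw [h, ← Algebra.commutes, ← Algebra.smul_def, map_sub, map_smul, map_smul]
    simp [Fintype.linearCombination_apply]
  | add a _ b _ ha hb =>
    rw [map_add]
    exact Submodule.add_mem _ ha hb

theorem minGenerators_syzygyHomology_le [IsNoetherianRing R] {n : ℕ} (x : Fin n → R) :
    minGenerators R (syzygyHomology (Fintype.linearCombination R x)) ≤
      minGenerators R (Koszul.homology x 1) := by
  set L := Fintype.linearCombination R x
  have hmem (a : LinearMap.ker L) : ExteriorAlgebra.ι R (a : Fin n → R) ∈ Koszul.cycles x 1 := by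
    refine ⟨?_, ?_⟩
    · rw [ExteriorAlgebra.exteriorPower, pow_one]
      exact ⟨_, rfl⟩
    · refine (CliffordAlgebra.contractLeft_ι _ L (a : Fin n → R)).trans ?_
      rw [LinearMap.mem_ker.1 a.2, map_zero]
  let φ : LinearMap.ker L →ₗ[R] Koszul.cycles x 1 :=
    (ExteriorAlgebra.ι R ∘ₗ (LinearMap.ker L).subtype).codRestrict _ hmem
  have hφ : Function.Surjective φ := by
    rintro ⟨w, hw, hd⟩
    rw [ExteriorAlgebra.exteriorPower, pow_one] at hw
    obtain ⟨a, rfl⟩ := hw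
    have ha : a ∈ LinearMap.ker L := by
      have h : algebraMap R (ExteriorAlgebra R (Fin n → R)) (L a) = 0 :=
        (CliffordAlgebra.contractLeft_ι _ L a).symm.trans hd
      exact (ExteriorAlgebra.algebraMap_eq_zero_iff _ _).1 h
    exact ⟨⟨a, ha⟩, rfl⟩
  have : Module.Finite R (Koszul.cycles x 1) := .of_surjective φ hφ
  refine minGenerators_le_of_ker_le (((Koszul.boundaries x 1).submoduleOf _).mkQ ∘ₗ φ)
    (Submodule.mkQ _) ((Submodule.mkQ_surjective _).comp hφ) (Submodule.mkQ_surjective _) ?_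
  intro a ha
  rw [LinearMap.mem_ker, LinearMap.comp_apply, Submodule.mkQ_apply,
    Submodule.Quotient.mk_eq_zero] at ha
  obtain ⟨b, hb, hab⟩ := boundaries_one_le x ha
  rw [LinearMap.mem_ker, Submodule.mkQ_apply, Submodule.Quotient.mk_eq_zero]
  have : b = a := (ExteriorAlgebra.ι_inj R _ _).1 hab
  rwa [this] at hb

theorem map_trivialSyzygies_comp_le (e : F →ₗ[R] G) (L : G →ₗ[R] R) :
    (trivialSyzygies (L ∘ₗ e)).map e ≤ trivialSyzygies L := by
  rw [trivialSyzygies, Submodule.map_span, Submodule.span_le]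
  rintro _ ⟨_, ⟨u, v, rfl⟩, rfl⟩
  simpa using sub_mem_trivialSyzygies L (e u) (e v)

/-- A linear change of coordinates does not increase the number of generators of the syzygy
homology, and the inverse change gives equality. -/
theorem minGenerators_syzygyHomology_equiv_le [IsNoetherianRing R] [Module.Finite R F]
    (e : F ≃ₗ[R] G) (L : G →ₗ[R] R) :
    minGenerators R (syzygyHomology L) ≤
      minGenerators R (syzygyHomology (L ∘ₗ e.toLinearMap)) := by
  let φ : LinearMap.ker (L ∘ₗ e.toLinearMap) →ₗ[R] LinearMap.ker L :=
    (e.toLinearMap ∘ₗ Submodule.subtype _).codRestrict _ fun a ↦ a.2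
  have hφ : Function.Surjective φ := by
    rintro ⟨w, hw⟩
    exact ⟨⟨e.symm w, by simpa using hw⟩, Subtype.ext (e.apply_symm_apply w)⟩
  refine minGenerators_le_of_ker_le (Submodule.mkQ _) (Submodule.mkQ _ ∘ₗ φ)
    (Submodule.mkQ_surjective _) ((Submodule.mkQ_surjective _).comp hφ) ?_
  intro a ha
  rw [LinearMap.mem_ker, Submodule.mkQ_apply, Submodule.Quotient.mk_eq_zero] at ha
  rw [LinearMap.mem_ker, LinearMap.comp_apply, Submodule.mkQ_apply, Submodule.Quotient.mk_eq_zero]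
  exact map_trivialSyzygies_comp_le e.toLinearMap L ⟨_, ha, rfl⟩

section BaseChange

variable {S : Type*} [CommRing S] {n : ℕ}

theorem map_linearCombination (f : R →+* S) (t a : Fin n → R) :
    Fintype.linearCombination S (f ∘ t) (f ∘ a) = f (Fintype.linearCombination R t a) := by
  simp [Fintype.linearCombination_apply]

theorem comp_mem_trivialSyzygies (f : R →+* S) (t : Fin n → R) {b : Fin n → R}
    (hb : b ∈ trivialSyzygies (Fintype.linearCombination R t)) :
    f ∘ b ∈ trivialSyzygies (Fintype.linearCombination S (f ∘ t)) := by
  induction hb using Submodule.span_induction with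
  | mem w hw =>
    obtain ⟨u, v, rfl⟩ := hw
    convert! sub_mem_trivialSyzygies (Fintype.linearCombination S (f ∘ t)) (f ∘ u) (f ∘ v) using 1
    rw [map_linearCombination, map_linearCombination]
    ext i
    simp
  | zero =>
    convert! zero_mem (trivialSyzygies (Fintype.linearCombination S (f ∘ t)))
    ext i
    simp
  | add a b _ _ ha hb =>
    convert! add_mem ha hb using 1
    ext i
    simp
  | smul r a _ ha =>
    convert! Submodule.smul_mem _ (f r) ha using 1
    ext i
    simp

theorem exists_comp_eq_of_mem_trivialSyzygies {f : R →+* S} (hf : Function.Surjective f)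
    (t : Fin n → R) {w : Fin n → S}
    (hw : w ∈ trivialSyzygies (Fintype.linearCombination S (f ∘ t))) :
    ∃ b ∈ trivialSyzygies (Fintype.linearCombination R t), f ∘ b = w := by
  induction hw using Submodule.span_induction with
  | mem w hw =>
    obtain ⟨u, v, rfl⟩ := hw
    obtain ⟨u, rfl⟩ := hf.comp_left u
    obtain ⟨v, rfl⟩ := hf.comp_left v
    refine ⟨_, sub_mem_trivialSyzygies _ u v, ?_⟩
    rw [map_linearCombination, map_linearCombination]
    ext i
    simp
  | zero => exact ⟨0, zero_mem _, by ext i; simp⟩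
  | add a b _ _ ha hb =>
    obtain ⟨a, ha, rfl⟩ := ha
    obtain ⟨b, hb, rfl⟩ := hb
    exact ⟨a + b, add_mem ha hb, by ext i; simp⟩
  | smul r a _ ha =>
    obtain ⟨r, rfl⟩ := hf r
    obtain ⟨a, ha, rfl⟩ := ha
    exact ⟨r • a, Submodule.smul_mem _ r ha, by ext i; simp⟩

end BaseChange

open IsLocalRing

/-- Adjoining redundant elements to a sequence that generates the maximal ideal: each of them adds
one generator to the first Koszul homology. -/
theorem minGenerators_syzygyHomology_coprod [IsLocalRing R] [IsNoetherianRing R]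
    [Module.Finite R F] [Module.Finite R G] [Module.Free R G]
    (L : F →ₗ[R] R) (L' : G →ₗ[R] R) (hL : LinearMap.range L = maximalIdeal R)
    (hL' : LinearMap.range L' ≤ maximalIdeal R) :
    minGenerators R (syzygyHomology (L.coprod L')) =
      minGenerators R (syzygyHomology L) + Module.finrank R G := by
  -- a change of coordinates that turns the form `L + L'` into `L + 0`
  obtain ⟨σ, hσ⟩ : ∃ σ : G →ₗ[R] F, L ∘ₗ σ = L' := by
    obtain ⟨τ, hτ⟩ := Module.projective_lifting_property L.rangeRestrict
      (L'.codRestrict (LinearMap.range L) fun v ↦ hL ▸ hL' ⟨v, rfl⟩) L.surjective_rangeRestrict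
    refine ⟨τ, LinearMap.ext fun v ↦ ?_⟩
    exact congrArg Subtype.val (LinearMap.congr_fun hτ v)
  have hσ' (v : G) : L (σ v) = L' v := LinearMap.congr_fun hσ v
  let φ : LinearMap.ker (L.coprod L') →ₗ[R] LinearMap.ker L × G :=
    ((((LinearMap.fst R F G) + σ ∘ₗ LinearMap.snd R F G) ∘ₗ
      Submodule.subtype _).codRestrict _ fun a ↦ by
        simpa only [LinearMap.coprod_apply, LinearMap.mem_ker, map_add, hσ',
          LinearMap.comp_apply, LinearMap.add_apply, LinearMap.fst_apply, LinearMap.snd_apply,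
          Submodule.subtype_apply] using LinearMap.mem_ker.1 a.2).prod
      (LinearMap.snd R F G ∘ₗ Submodule.subtype _)
  have hφ : Function.Surjective φ := by
    rintro ⟨⟨u, hu⟩, v⟩
    refine ⟨⟨(u - σ v, v), by simpa [hσ', sub_eq_zero] using hu⟩, ?_⟩
    exact Prod.ext (Subtype.ext (sub_add_cancel u (σ v))) rfl
  -- the trivial syzygies of `L + 0`
  have key (w : F × G) (hw : w ∈ trivialSyzygies (L.coprod L')) :
      w.1 + σ w.2 ∈ trivialSyzygies L ∧ w.2 ∈ maximalIdeal R • (⊤ : Submodule R G) := by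
    induction hw using Submodule.span_induction with
    | mem w hw =>
      obtain ⟨⟨u, u'⟩, ⟨v, v'⟩, rfl⟩ := hw
      have h (p : F) (q : G) : L p + L' q ∈ maximalIdeal R :=
        add_mem (hL ▸ ⟨p, rfl⟩) (hL' ⟨q, rfl⟩)
      refine ⟨?_, sub_mem (Submodule.smul_mem_smul (by simpa using h u u') trivial)
        (Submodule.smul_mem_smul (by simpa using h v v') trivial)⟩
      convert! sub_mem_trivialSyzygies L (u + σ u') (v + σ v') using 1
      simp only [map_add, hσ', LinearMap.coprod_apply, Prod.fst_sub, Prod.smul_fst, Prod.snd_sub,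
        Prod.smul_snd, map_sub, map_smul, smul_add]
      abel
    | zero => simp
    | add a b _ _ ha hb =>
      refine ⟨?_, add_mem ha.2 hb.2⟩
      convert! add_mem ha.1 hb.1 using 1
      simp only [Prod.fst_add, Prod.snd_add, map_add]
      abel
    | smul r a _ ha =>
      refine ⟨?_, Submodule.smul_mem _ r ha.2⟩
      convert! Submodule.smul_mem _ r ha.1 using 1
      simp
  rw [← minGenerators_eq_finrank_of_free (R := R) (Q := G), ← minGenerators_prod]
  apply le_antisymm
  · refine minGenerators_le_of_ker_le
      ((LinearMap.prodMap (Submodule.mkQ ((trivialSyzygies L).submoduleOf (LinearMap.ker L)))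
        LinearMap.id) ∘ₗ φ) (Submodule.mkQ _)
      ((Function.Surjective.prodMap (Submodule.mkQ_surjective _) Function.surjective_id).comp hφ)
      (Submodule.mkQ_surjective _) ?_
    intro a ha
    rw [LinearMap.mem_ker, Submodule.mkQ_apply, Submodule.Quotient.mk_eq_zero]
    obtain ⟨⟨p, q⟩, hpq⟩ := a
    rw [LinearMap.mem_ker] at ha
    obtain ⟨h1, h2⟩ := Prod.ext_iff.1 ha
    have h2 : q = 0 := h2
    subst h2
    replace h1 : p + σ 0 ∈ trivialSyzygies L :=
      (Submodule.Quotient.mk_eq_zero ((trivialSyzygies L).submoduleOf (LinearMap.ker L))).1 h1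
    rw [map_zero, add_zero] at h1
    change (p, (0 : G)) ∈ trivialSyzygies (L.coprod L')
    clear ha h2 hpq
    induction h1 using Submodule.span_induction with
    | mem w hw =>
      obtain ⟨u, v, rfl⟩ := hw
      simpa using sub_mem_trivialSyzygies (L.coprod L') (u, 0) (v, 0)
    | zero => exact zero_mem _
    | add a b _ _ ha hb => simpa using add_mem ha hb
    | smul r a _ ha => simpa using Submodule.smul_mem _ r ha
  · refine minGenerators_le_of_ker_le_comap (Submodule.mkQ
        ((trivialSyzygies (L.coprod L')).submoduleOf (LinearMap.ker (L.coprod L'))))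
      ((LinearMap.prodMap (Submodule.mkQ ((trivialSyzygies L).submoduleOf (LinearMap.ker L)))
        LinearMap.id) ∘ₗ φ) (Submodule.mkQ_surjective _)
      ((Function.Surjective.prodMap (Submodule.mkQ_surjective _) Function.surjective_id).comp hφ)
      ?_
    intro a ha
    rw [LinearMap.mem_ker, Submodule.mkQ_apply, Submodule.Quotient.mk_eq_zero] at ha
    obtain ⟨h1, h2⟩ := key _ ha
    rw [Submodule.mem_comap]
    have : (LinearMap.prodMap (Submodule.mkQ ((trivialSyzygies L).submoduleOf (LinearMap.ker L)))
        LinearMap.id ∘ₗ φ) a = LinearMap.inr R _ _ (a : F × G).2 :=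
      Prod.ext ((Submodule.Quotient.mk_eq_zero _).2 h1) rfl
    rw [this]
    have h3 := Submodule.mem_map_of_mem (f := LinearMap.inr R (syzygyHomology L) G) h2
    rw [Submodule.map_smul''] at h3
    exact Submodule.smul_mono le_rfl le_top h3

/-- For two sequences that generate the maximal ideal, the numbers of generators of the first Koszul
homology differ as the lengths of the sequences do. -/
theorem minGenerators_syzygyHomology_add_finrank [IsLocalRing R] [IsNoetherianRing R]
    [Module.Finite R F] [Module.Free R F] [Module.Finite R G] [Module.Free R G]
    (L : F →ₗ[R] R) (L' : G →ₗ[R] R) (hL : LinearMap.range L = maximalIdeal R)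
    (hL' : LinearMap.range L' = maximalIdeal R) :
    minGenerators R (syzygyHomology L) + Module.finrank R G =
      minGenerators R (syzygyHomology L') + Module.finrank R F := by
  rw [← minGenerators_syzygyHomology_coprod L L' hL hL'.le,
    ← minGenerators_syzygyHomology_coprod L' L hL' hL.le]
  have h1 : L'.coprod L ∘ₗ (LinearEquiv.prodComm R F G).toLinearMap = L.coprod L' := by
    ext <;> simp
  have h2 : L.coprod L' ∘ₗ (LinearEquiv.prodComm R G F).toLinearMap = L'.coprod L := by
    ext <;> simp
  refine le_antisymm ?_ ?_
  · conv_rhs => rw [← h2]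
    exact minGenerators_syzygyHomology_equiv_le _ _
  · conv_rhs => rw [← h1]
    exact minGenerators_syzygyHomology_equiv_le _ _

end Syzygies

/-! ### Regular local rings -/

section RegularSystem

open IsLocalRing

variable {R : Type*} [CommRing R] [IsLocalRing R]

theorem isLocalRing_quotient {I : Ideal R} (hI : I ≤ maximalIdeal R) : IsLocalRing (R ⧸ I) := by
  have : Nontrivial (R ⧸ I) :=
    Ideal.Quotient.nontrivial_iff.2 fun h ↦ (maximalIdeal.isMaximal R).ne_top (top_unique (h ▸ hI))
  exact IsLocalRing.of_surjective' (Ideal.Quotient.mk I) Ideal.Quotient.mk_surjective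

theorem maximalIdeal_eq_map_of_surjective {S : Type*} [CommRing S] [IsLocalRing S] {f : R →+* S}
    (hf : Function.Surjective f) : maximalIdeal S = (maximalIdeal R).map f := by
  have : IsLocalHom f := hf.isLocalHom
  have h : (maximalIdeal S).comap f = maximalIdeal R := ((local_hom_TFAE f).out 0 4).1 this
  rw [← h, Ideal.map_comap_of_surjective f hf]

/-- The quotient by one of `d + 1` generators of the maximal ideal has a maximal ideal with `d`
generators, while the dimension drops by at most one. In particular it is again regular if
`R` is. -/
theorem span_quotient_singleton [IsNoetherianRing R] {d : ℕ} {x : R} {t : Fin d → R}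
    (ht : Ideal.span (insert x (Set.range t)) = maximalIdeal R)
    (hd : ((d + 1 : ℕ) : WithBot ℕ∞) ≤ ringKrullDim R) [IsLocalRing (R ⧸ Ideal.span {x})] :
    Ideal.span (Set.range (Ideal.Quotient.mk (Ideal.span {x}) ∘ t)) =
        maximalIdeal (R ⧸ Ideal.span {x}) ∧
      (d : WithBot ℕ∞) ≤ ringKrullDim (R ⧸ Ideal.span {x}) := by
  constructor
  · rw [maximalIdeal_eq_map_of_surjective (Ideal.Quotient.mk_surjective (I := Ideal.span {x})),
      ← ht,
      Ideal.span_insert, Ideal.map_sup, Ideal.map_quotient_self, bot_sup_eq, Ideal.map_span,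
      Set.range_comp]
  · have hx : x ∈ maximalIdeal R := ht ▸ Ideal.subset_span (Set.mem_insert _ _)
    have h := ringKrullDim_le_ringKrullDim_quotient_add_card ({x} : Finset R)
      (by simpa [IsLocalRing.ringJacobson_eq_maximalIdeal] using hx)
    rw [Finset.coe_singleton, Finset.card_singleton] at h
    have h2 := hd.trans h
    push_cast at h2
    exact ENat.WithBot.add_le_add_one_right_iff.1 h2

/-- A regular local ring is a domain. Prime avoidance gives an element `x ∈ 𝔪 \ 𝔪 ^ 2` outside all
minimal primes. By induction `R ⧸ (x)` is a domain, so `(x)` contains a minimal prime `P`, and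
`P = x P` vanishes by Nakayama's lemma. -/
theorem isDomain_of_span_range_eq_maximalIdeal.{u} (d : ℕ) : ∀ (R : Type u) [CommRing R]
    [IsLocalRing R] [IsNoetherianRing R] (t : Fin d → R),
    Ideal.span (Set.range t) = maximalIdeal R → (d : WithBot ℕ∞) ≤ ringKrullDim R →
    IsDomain R := by
  induction d with
  | zero =>
    intro R _ _ _ t ht _
    have : maximalIdeal R = ⊥ := by rw [← ht]; simp
    exact (isField_iff_maximalIdeal_eq.2 this).isDomain
  | succ d ih =>
    intro R _ _ _ t ht hd
    have hht : (maximalIdeal R).height ≠ 0 := by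
      intro h
      rw [← maximalIdeal_height_eq_ringKrullDim, h] at hd
      have : ((d + 1 : ℕ) : WithBot ℕ∞) ≤ ((0 : ℕ) : WithBot ℕ∞) := hd
      rw [Nat.cast_le] at this
      omega
    obtain ⟨x, hxm, hxsq, hxP⟩ : ∃ x ∈ maximalIdeal R, x ∉ maximalIdeal R ^ 2 ∧
        ∀ P ∈ minimalPrimes R, x ∉ P := by
      by_contra! hcon
      have hfin := minimalPrimes.finite_of_isNoetherianRing R
      have hsub : (maximalIdeal R : Set R) ⊆
          ⋃ i ∈ ((insert (maximalIdeal R ^ 2) hfin.toFinset : Finset (Ideal R)) :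
            Set (Ideal R)), ((id i : Ideal R) : Set R) := by
        intro x hx
        by_cases h : x ∈ maximalIdeal R ^ 2
        · exact Set.mem_biUnion (by simp) h
        · obtain ⟨P, hP, hxP⟩ := hcon x hx h
          exact Set.mem_biUnion (by simp [hP]) hxP
      rw [Ideal.subset_union_prime (maximalIdeal R ^ 2) (maximalIdeal R ^ 2)] at hsub
      · obtain ⟨I, hI, hle⟩ := hsub
        rw [Finset.mem_insert, Set.Finite.mem_toFinset] at hI
        rcases hI with rfl | hI
        · have hbot : maximalIdeal R = ⊥ := by
            refine Submodule.eq_bot_of_le_smul_of_le_jacobson_bot (maximalIdeal R) _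
              (IsNoetherian.noetherian _) ?_ (maximalIdeal_le_jacobson _)
            rwa [smul_eq_mul, ← pow_two]
          refine hht ?_
          rw [hbot]
          have : IsDomain R := (isField_iff_maximalIdeal_eq.2 hbot).isDomain
          exact Ideal.height_bot
        · have : I = maximalIdeal R := le_antisymm (le_maximalIdeal hI.1.1.ne_top) hle
          subst this
          exact hht (Ideal.height_eq_zero_iff.2 hI)
      · intro I hI h _
        rw [Finset.mem_insert, Set.Finite.mem_toFinset] at hI
        exact (hI.resolve_left h).1.1
    obtain ⟨c, hc⟩ : ∃ c : Fin (d + 1) → R, ∑ i, c i * t i = x := by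
      rw [← ht] at hxm
      exact Ideal.mem_span_range_iff_exists_fun.1 hxm
    have htm (i) : t i ∈ maximalIdeal R := ht ▸ Ideal.subset_span ⟨i, rfl⟩
    obtain ⟨j, hj⟩ : ∃ j, IsUnit (c j) := by
      by_contra! hcon
      refine hxsq (hc ▸ sum_mem fun i _ ↦ ?_)
      rw [pow_two]
      exact Ideal.mul_mem_mul ((mem_maximalIdeal _).2 (hcon i)) (htm i)
    -- `x` may replace the generator `t j`, since its coefficient in `x` is a unit
    have hspan : Ideal.span (insert x (Set.range (t ∘ j.succAbove))) = maximalIdeal R := by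
      refine le_antisymm (Ideal.span_le.2 (Set.insert_subset hxm ?_)) ?_
      · rintro _ ⟨i, rfl⟩
        exact htm _
      · rw [← ht, Ideal.span_le]
        have hs (i) : t (j.succAbove i) ∈
            Ideal.span (insert x (Set.range (t ∘ j.succAbove))) :=
          Ideal.subset_span (Set.mem_insert_of_mem _ ⟨i, rfl⟩)
        rintro _ ⟨i, rfl⟩
        rcases Fin.eq_self_or_eq_succAbove j i with rfl | ⟨i, rfl⟩
        · refine (Ideal.unit_mul_mem_iff_mem _ hj).1 ?_
          rw [Fin.sum_univ_succAbove _ i] at hc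
          rw [eq_sub_of_add_eq hc]
          exact sub_mem (Ideal.subset_span (Set.mem_insert _ _))
            (sum_mem fun i _ ↦ Ideal.mul_mem_left _ _ (hs i))
        · exact hs i
    have := isLocalRing_quotient (I := Ideal.span {x})
      ((Ideal.span_singleton_le_iff_mem _).2 hxm)
    obtain ⟨h1, h2⟩ := span_quotient_singleton hspan hd
    have hdom := ih (R ⧸ Ideal.span {x}) _ h1 h2
    have hprime : (Ideal.span {x}).IsPrime := (Ideal.Quotient.isDomain_iff_prime _).1 hdom
    obtain ⟨P, hP, hPx⟩ := Ideal.exists_minimalPrimes_le (bot_le (a := Ideal.span {x}))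
    have hPprime : P.IsPrime := hP.1.1
    have hPbot : P = ⊥ := by
      refine Submodule.eq_bot_of_le_smul_of_le_jacobson_bot (maximalIdeal R) _
        (IsNoetherian.noetherian _) ?_ (maximalIdeal_le_jacobson _)
      intro y hy
      obtain ⟨z, rfl⟩ := Ideal.mem_span_singleton'.1 (hPx hy)
      rw [mul_comm]
      exact Submodule.smul_mem_smul hxm ((hPprime.mem_or_mem hy).resolve_right (hxP P hP))
    rw [hPbot] at hPprime
    exact IsDomain.of_bot_isPrime R

/-- A regular system of parameters has only trivial syzygies. Modulo `t 0` a syzygy of `t` becomes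
a syzygy of the remaining parameters, which is trivial by induction. Up to trivial syzygies it is
thus supported in the coordinate `0`. -/
theorem ker_le_trivialSyzygies.{u} (d : ℕ) : ∀ (R : Type u) [CommRing R]
    [IsLocalRing R] [IsNoetherianRing R] (t : Fin d → R),
    Ideal.span (Set.range t) = maximalIdeal R → (d : WithBot ℕ∞) ≤ ringKrullDim R →
    LinearMap.ker (Fintype.linearCombination R t) ≤
      trivialSyzygies (Fintype.linearCombination R t) := by
  induction d with
  | zero =>
    intro R _ _ _ t _ _ a _
    rw [Subsingleton.elim a 0]
    exact zero_mem _
  | succ d ih =>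
    intro R _ _ _ t ht hd a ha
    have hdom := isDomain_of_span_range_eq_maximalIdeal _ R t ht hd
    have hspan : Ideal.span (insert (t 0) (Set.range (t ∘ Fin.succ))) = maximalIdeal R := by
      rw [← ht, ← Fin.range_cons]
      exact congrArg (fun s ↦ Ideal.span (Set.range s)) (Fin.cons_self_tail t)
    have := isLocalRing_quotient (I := Ideal.span {t 0})
      ((Ideal.span_singleton_le_iff_mem _).2 (ht ▸ Ideal.subset_span ⟨0, rfl⟩))
    have ht0 : t 0 ≠ 0 := by
      intro h0
      rw [h0, Ideal.span_insert_zero] at hspan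
      have h1 := hd.trans (ringKrullDim_le_spanFinrank_maximalIdeal R)
      rw [Nat.cast_le, ← hspan] at h1
      have h2 := h1.trans (Submodule.spanFinrank_span_le_ncard_of_finite (Set.finite_range _))
      have h3 : (Set.range (t ∘ Fin.succ)).ncard ≤ d := by
        rw [← Set.image_univ]
        exact (Set.ncard_image_le Set.finite_univ).trans (by simp)
      omega
    obtain ⟨h1, h2⟩ := span_quotient_singleton hspan hd
    set π := Ideal.Quotient.mk (Ideal.span {t 0})
    have hsum : a 0 * t 0 + ∑ i : Fin d, a i.succ * t i.succ = 0 := by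
      rw [← Fin.sum_univ_succ (fun i ↦ a i * t i)]
      simpa [Fintype.linearCombination_apply] using ha
    have hπ : π ∘ (a ∘ Fin.succ) ∈
        LinearMap.ker (Fintype.linearCombination _ (π ∘ (t ∘ Fin.succ))) := by
      rw [LinearMap.mem_ker, map_linearCombination, Ideal.Quotient.eq_zero_iff_mem,
        Ideal.mem_span_singleton]
      refine ⟨- a 0, ?_⟩
      simp only [Fintype.linearCombination_apply, Function.comp_apply, smul_eq_mul]
      linear_combination hsum
    obtain ⟨b, hb, hba⟩ := exists_comp_eq_of_mem_trivialSyzygies Ideal.Quotient.mk_surjective _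
      (ih _ _ h1 h2 hπ)
    have hex (i : Fin d) : ∃ c, a i.succ - b i = t 0 * c := by
      rw [← dvd_def, ← Ideal.mem_span_singleton, ← Ideal.Quotient.eq]
      exact (congrFun hba i).symm
    choose c hc using hex
    let shift : (Fin d → R) →ₗ[R] (Fin (d + 1) → R) :=
      { toFun := Fin.cons (α := fun _ ↦ R) 0
        map_add' u v := by ext i; refine Fin.cases ?_ (fun i ↦ ?_) i <;> simp
        map_smul' r v := by ext i; refine Fin.cases ?_ (fun i ↦ ?_) i <;> simp }
    have hshift : Fintype.linearCombination R t ∘ₗ shift =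
        Fintype.linearCombination R (t ∘ Fin.succ) := by
      refine LinearMap.ext fun v ↦ ?_
      simp [Fintype.linearCombination_apply, shift, Fin.sum_univ_succ]
    have hb' : shift b ∈ trivialSyzygies (Fintype.linearCombination R t) :=
      map_trivialSyzygies_comp_le shift _ ⟨b, hshift ▸ hb, rfl⟩
    have hb0 : ∑ i : Fin d, b i * t i.succ = 0 := by
      simpa [Fintype.linearCombination_apply] using trivialSyzygies_le_ker _ hb
    -- the coordinate `0` of the remainder is annihilated by `t 0`, which is not a zero divisor
    have ha0 : a 0 = - ∑ i : Fin d, c i * t i.succ := by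
      refine mul_right_cancel₀ ht0 ?_
      have : ∑ i : Fin d, a i.succ * t i.succ = t 0 * ∑ i : Fin d, c i * t i.succ := by
        rw [← sub_zero (∑ i : Fin d, a i.succ * t i.succ), ← hb0, ← Finset.sum_sub_distrib,
          Finset.mul_sum]
        exact Finset.sum_congr rfl fun i _ ↦ by rw [← sub_mul, hc, mul_assoc]
      linear_combination hsum - this
    have hc' := sub_mem_trivialSyzygies (Fintype.linearCombination R t) (Pi.single 0 1) (shift c)
    convert! add_mem hb' hc' using 1
    ext i
    refine Fin.cases ?_ (fun i ↦ ?_) i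
    · simp [shift, Fintype.linearCombination_apply, Fin.sum_univ_succ, ha0]
    · simp [shift, Fintype.linearCombination_apply, Fin.sum_univ_succ, Pi.single_apply, ← hc]

end RegularSystem

/-! ### Presentations by regular local rings -/

section Presentation

open IsLocalRing

variable {T B : Type*} [CommRing T] [CommRing B]

/-- If a form on `Tⁿ` is reduced along a surjection `f : T → B`, then a lift of a trivial syzygy is
trivial up to a vector with entries in `ker f`. -/
theorem exists_sub_mem_ker {f : T →+* B} (hf : Function.Surjective f) {n : ℕ} (t a : Fin n → T)
    (ha : f ∘ a ∈ trivialSyzygies (Fintype.linearCombination B (f ∘ t))) :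
    ∃ b ∈ trivialSyzygies (Fintype.linearCombination T t), ∀ i, a i - b i ∈ RingHom.ker f := by
  obtain ⟨b, hb, h⟩ := exists_comp_eq_of_mem_trivialSyzygies hf t ha
  refine ⟨b, hb, fun i ↦ ?_⟩
  rw [RingHom.mem_ker, map_sub, sub_eq_zero]
  exact (congrFun h i).symm

/-- The syzygies over `B` of the image of `t`, as images of the vectors `a` over `T` for which
`∑ a i * t i` lies in `ker f`. -/
def liftSyzygy (f : T →+* B) {n : ℕ} (t : Fin n → T) :
    Submodule.comap (Fintype.linearCombination T t) (RingHom.ker f) →ₛₗ[f]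
      LinearMap.ker (Fintype.linearCombination B (f ∘ t)) where
  toFun a := ⟨f ∘ (a : Fin n → T), by
    rw [LinearMap.mem_ker, map_linearCombination]
    exact a.2⟩
  map_add' a b := by ext i; simp
  map_smul' r a := by ext i; simp

theorem liftSyzygy_surjective {f : T →+* B} (hf : Function.Surjective f) {n : ℕ} (t : Fin n → T) :
    Function.Surjective (liftSyzygy f t) := by
  rintro ⟨w, hw⟩
  obtain ⟨a, rfl⟩ := hf.comp_left w
  rw [LinearMap.mem_ker, map_linearCombination] at hw
  exact ⟨⟨a, hw⟩, rfl⟩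

theorem range_linearCombination {n : ℕ} (t : Fin n → T) :
    LinearMap.range (Fintype.linearCombination T t) = Ideal.span (Set.range t) :=
  Fintype.range_linearCombination T t

theorem mem_smul_top_of_forall_mem {n : ℕ} {I : Ideal T} {a : Fin n → T} (ha : ∀ i, a i ∈ I) :
    a ∈ I • (⊤ : Submodule T (Fin n → T)) := by
  rw [pi_eq_sum_univ' a]
  exact sum_mem fun i _ ↦ Submodule.smul_mem_smul (ha i) trivial

theorem smul_mem_smul_top {I J : Ideal T} {r s : T} (hr : r ∈ J) (hs : s ∈ I) (h : r * s ∈ I) :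
    (⟨r * s, h⟩ : I) ∈ J • (⊤ : Submodule T I) :=
  Submodule.smul_mem_smul (n := (⟨s, hs⟩ : I)) hr trivial

/-- For `f : T → B` with `T` regular local and `t` a regular system of parameters, `ker f` needs as
many generators as the first Koszul homology of the image of `t` in `B`: both are
`Tor₁(B, T / 𝔪)` up to Nakayama's lemma. -/
theorem minGenerators_ker_eq [IsLocalRing T] [IsNoetherianRing T] [Nontrivial B] {f : T →+* B}
    (hf : Function.Surjective f) {d : ℕ} (t : Fin d → T)
    (ht : Ideal.span (Set.range t) = maximalIdeal T)
    (hd : (d : WithBot ℕ∞) ≤ ringKrullDim T) :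
    minGenerators T (RingHom.ker f) =
      minGenerators B (syzygyHomology (Fintype.linearCombination B (f ∘ t))) := by
  have : RingHomSurjective f := ⟨hf⟩
  have : IsNoetherianRing B := isNoetherianRing_of_surjective T B f hf
  set L := Fintype.linearCombination T t
  set I := RingHom.ker f
  have hI : I ≤ maximalIdeal T := le_maximalIdeal (RingHom.ker_ne_top f)
  let φ : Submodule.comap L I →ₛₗ[f] syzygyHomology (Fintype.linearCombination B (f ∘ t)) :=
    (Submodule.mkQ _).comp (liftSyzygy f t)
  have hφ : Function.Surjective φ :=
    (Submodule.mkQ_surjective _).comp (liftSyzygy_surjective hf t)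
  let ψ : Submodule.comap L I →ₗ[T] I := (L ∘ₗ Submodule.subtype _).codRestrict I fun a ↦ a.2
  have hψ : Function.Surjective ψ := by
    rintro ⟨i, hi⟩
    have h := hI hi
    rw [← ht, ← range_linearCombination] at h
    obtain ⟨a, rfl⟩ := h
    exact ⟨⟨a, hi⟩, rfl⟩
  have hker (a : Submodule.comap L I) (ha : φ a = 0) :
      f ∘ (a : Fin d → T) ∈ trivialSyzygies (Fintype.linearCombination B (f ∘ t)) :=
    (Submodule.Quotient.mk_eq_zero ((trivialSyzygies _).submoduleOf _)).1 ha
  apply le_antisymm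
  · refine minGenerators_le_of_ker_le_comap φ ψ hφ hψ ?_
    intro a ha
    obtain ⟨b, hb, hab⟩ := exists_sub_mem_ker hf t a (hker a ha)
    have hL : L (a : Fin d → T) = ∑ i, t i * ((a : Fin d → T) i - b i) := by
      have h0 : L b = 0 := trivialSyzygies_le_ker _ hb
      rw [← sub_zero (L a), ← h0, ← map_sub]
      simp [L, Fintype.linearCombination_apply, mul_comm]
    have hmem (i) : t i * ((a : Fin d → T) i - b i) ∈ I := Ideal.mul_mem_left _ _ (hab i)
    have hψa : ψ a = ∑ i, (⟨_, hmem i⟩ : I) := by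
      refine Subtype.ext ?_
      rw [AddSubmonoidClass.coe_finsetSum]
      exact hL
    rw [Submodule.mem_comap, hψa]
    exact sum_mem fun i _ ↦ smul_mem_smul_top (ht ▸ Ideal.subset_span ⟨i, rfl⟩) (hab i) _
  · refine minGenerators_le_of_ker_le ψ φ hψ hφ ?_
    intro a ha
    have hLa : L (a : Fin d → T) = 0 := congrArg Subtype.val (LinearMap.mem_ker.1 ha)
    exact (Submodule.Quotient.mk_eq_zero ((trivialSyzygies _).submoduleOf _)).2
      (comp_mem_trivialSyzygies f t (ker_le_trivialSyzygies d T t ht hd hLa))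

theorem exists_span_range_eq_maximalIdeal [IsLocalRing T] [IsNoetherianRing T] :
    ∃ t : Fin (maximalIdeal T).spanFinrank → T, Ideal.span (Set.range t) = maximalIdeal T := by
  have hfg : (maximalIdeal T).FG := IsNoetherian.noetherian _
  obtain ⟨s, hs, hspan⟩ := Submodule.FG.exists_span_finset_card_eq_spanFinrank hfg
  refine ⟨fun i ↦ (s.equivFinOfCardEq hs).symm i, ?_⟩
  refine (congrArg (Submodule.span T) ?_).trans hspan
  ext y
  simp only [Set.mem_range, SetLike.mem_coe]
  constructor
  · rintro ⟨i, rfl⟩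
    exact Subtype.prop _
  · intro hy
    exact ⟨s.equivFinOfCardEq hs ⟨y, hy⟩, by simp⟩

/-- For a presentation `T → B` of a local ring `B` with `T` regular local, the number
`ν(ker f) - dim T` does not depend on the presentation. -/
theorem minGenerators_ker_add_spanFinrank {T' : Type*} [CommRing T'] [IsRegularLocalRing T]
    [IsRegularLocalRing T'] [Nontrivial B] {f : T →+* B} {g : T' →+* B}
    (hf : Function.Surjective f) (hg : Function.Surjective g) :
    minGenerators T (RingHom.ker f) + (maximalIdeal T').spanFinrank =
      minGenerators T' (RingHom.ker g) + (maximalIdeal T).spanFinrank := by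
  have : IsLocalRing B := IsLocalRing.of_surjective' f hf
  have : IsNoetherianRing B := isNoetherianRing_of_surjective T B f hf
  obtain ⟨t, ht⟩ := exists_span_range_eq_maximalIdeal (T := T)
  obtain ⟨s, hs⟩ := exists_span_range_eq_maximalIdeal (T := T')
  rw [minGenerators_ker_eq hf t ht IsRegularLocalRing.spanFinrank_maximalIdeal.le,
    minGenerators_ker_eq hg s hs IsRegularLocalRing.spanFinrank_maximalIdeal.le]
  have := minGenerators_syzygyHomology_add_finrank (Fintype.linearCombination B (f ∘ t))
    (Fintype.linearCombination B (g ∘ s))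
    (by rw [range_linearCombination, Set.range_comp, ← Ideal.map_span, ht,
      ← maximalIdeal_eq_map_of_surjective hf])
    (by rw [range_linearCombination, Set.range_comp, ← Ideal.map_span, hs,
      ← maximalIdeal_eq_map_of_surjective hg])
  simpa using this

/-- For `A = T / I` and `x` in the maximal ideal, the surjection `I × Tⁿ → I + (x)` has kernel the
syzygies of `x` in `A`, lifted to `T`. Modulo `𝔪 (I × Tⁿ)` this kernel is a quotient of the first
Koszul homology, which gives the inequality. -/
theorem minGenerators_ker_add_le [IsLocalRing T] [IsNoetherianRing T] [Nontrivial B] {f : T →+* B}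
    (hf : Function.Surjective f) {n : ℕ} (x : Fin n → T) (hx : ∀ i, x i ∈ maximalIdeal T) :
    minGenerators T (RingHom.ker f) + n ≤
      minGenerators B (syzygyHomology (Fintype.linearCombination B (f ∘ x))) +
        minGenerators T ↥(RingHom.ker f ⊔ Ideal.span (Set.range x)) := by
  have : RingHomSurjective f := ⟨hf⟩
  have : IsNoetherianRing B := isNoetherianRing_of_surjective T B f hf
  set L := Fintype.linearCombination T x
  set I := RingHom.ker f
  have hI : I ≤ maximalIdeal T := le_maximalIdeal (RingHom.ker_ne_top f)
  have hL (u : Fin n → T) : L u ∈ maximalIdeal T := by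
    simp only [L, Fintype.linearCombination_apply, smul_eq_mul]
    exact sum_mem fun i _ ↦ Ideal.mul_mem_left _ _ (hx i)
  set W : Submodule T (I × (Fin n → T)) := maximalIdeal T • ⊤
  have hinl {i : I} (hi : i ∈ maximalIdeal T • (⊤ : Submodule T I)) : (i, 0) ∈ W := by
    have h := Submodule.mem_map_of_mem (f := LinearMap.inl T I (Fin n → T)) hi
    rw [Submodule.map_smul''] at h
    exact Submodule.smul_mono le_rfl le_top h
  have hinr {a : Fin n → T} (ha : a ∈ maximalIdeal T • (⊤ : Submodule T (Fin n → T))) :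
      (0, a) ∈ W := by
    have h := Submodule.mem_map_of_mem (f := LinearMap.inr T I (Fin n → T)) ha
    rw [Submodule.map_smul''] at h
    exact Submodule.smul_mono le_rfl le_top h
  let π : I × (Fin n → T) →ₗ[T] ↥(I ⊔ Ideal.span (Set.range x)) :=
    (I.subtype.coprod L).codRestrict _ fun p ↦ by
      refine add_mem (Ideal.mem_sup_left p.1.2) (Ideal.mem_sup_right ?_)
      rw [← range_linearCombination]
      exact ⟨_, rfl⟩
  have hπ : Function.Surjective π := by
    rintro ⟨y, hy⟩
    obtain ⟨i, hi, z, hz, rfl⟩ := Submodule.mem_sup.1 hy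
    rw [← range_linearCombination] at hz
    obtain ⟨a, rfl⟩ := hz
    exact ⟨(⟨i, hi⟩, a), rfl⟩
  -- the syzygies of `x` in `B`, embedded in the kernel of `π`
  let j : Submodule.comap L I →ₗ[T] LinearMap.ker π :=
    ((-((L ∘ₗ Submodule.subtype _).codRestrict I fun a ↦ a.2)).prod
      (Submodule.subtype _)).codRestrict _ fun a ↦ by
        refine LinearMap.mem_ker.2 (Subtype.ext ?_)
        exact neg_add_cancel (L a)
  have hj : Function.Surjective j := by
    rintro ⟨⟨i, a⟩, h⟩
    have h0 : (i : T) + L a = 0 := congrArg Subtype.val (LinearMap.mem_ker.1 h)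
    have hi : L a = -(i : T) := eq_neg_of_add_eq_zero_right h0
    refine ⟨⟨a, ?_⟩, Subtype.ext (Prod.ext (Subtype.ext ?_) rfl)⟩
    · rw [Submodule.mem_comap, hi]
      exact neg_mem i.2
    · change -(L a) = i
      rw [hi, neg_neg]
  let K := (LinearMap.ker π).map W.mkQ
  have h1 : minGenerators T K ≤
      minGenerators B (syzygyHomology (Fintype.linearCombination B (f ∘ x))) := by
    refine minGenerators_le_of_ker_le
      (((trivialSyzygies (Fintype.linearCombination B (f ∘ x))).submoduleOf _).mkQ.comp
        (liftSyzygy f x))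
      ((W.mkQ.submoduleMap (LinearMap.ker π)) ∘ₗ j)
      ((Submodule.mkQ_surjective _).comp (liftSyzygy_surjective hf x))
      ((W.mkQ.submoduleMap_surjective _).comp hj) ?_
    intro a ha
    obtain ⟨b, hb, hab⟩ := exists_sub_mem_ker hf x a
      ((Submodule.Quotient.mk_eq_zero ((trivialSyzygies _).submoduleOf _)).1 ha)
    have hLab : L (a : Fin n → T) = ∑ i, x i * ((a : Fin n → T) i - b i) := by
      have h0 : L b = 0 := trivialSyzygies_le_ker _ hb
      rw [← sub_zero (L a), ← h0, ← map_sub]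
      simp [L, Fintype.linearCombination_apply, mul_comm]
    have hmem (i) : x i * ((a : Fin n → T) i - b i) ∈ I := Ideal.mul_mem_left _ _ (hab i)
    have hfst : (j a).1.1 = -∑ i, (⟨_, hmem i⟩ : I) := by
      refine Subtype.ext ?_
      rw [NegMemClass.coe_neg, AddSubmonoidClass.coe_finsetSum]
      exact congrArg Neg.neg hLab
    have hbm : b ∈ maximalIdeal T • (⊤ : Submodule T (Fin n → T)) := by
      refine Submodule.span_le.2 ?_ hb
      rintro _ ⟨u, v, rfl⟩
      exact sub_mem (Submodule.smul_mem_smul (hL u) trivial)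
        (Submodule.smul_mem_smul (hL v) trivial)
    refine LinearMap.mem_ker.2 (Subtype.ext ((Submodule.Quotient.mk_eq_zero W).2 ?_))
    have hdecomp : (j a).1 = ((j a).1.1, 0) + ((0, b) + (0, (a : Fin n → T) - b)) := by
      refine Prod.ext ?_ ?_
      · simp
      · change (a : Fin n → T) = 0 + (b + (a - b))
        abel
    rw [Submodule.subtype_apply, hdecomp]
    refine add_mem (hinl ?_) (add_mem (hinr hbm) (hinr ?_))
    · rw [hfst]
      exact neg_mem (sum_mem fun i _ ↦ smul_mem_smul_top (hx i) (hab i) _)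
    · exact mem_smul_top_of_forall_mem fun i ↦ hI (hab i)
  have h2 : minGenerators T ((_ ⧸ W) ⧸ K) ≤
      minGenerators T ↥(I ⊔ Ideal.span (Set.range x)) := by
    refine minGenerators_le_of_ker_le π (K.mkQ ∘ₗ W.mkQ) hπ
      ((Submodule.mkQ_surjective _).comp (Submodule.mkQ_surjective _)) ?_
    intro p hp
    exact (Submodule.Quotient.mk_eq_zero K).2 ⟨p, hp, rfl⟩
  calc minGenerators T I + n = minGenerators T (I × (Fin n → T)) := by
        rw [minGenerators_prod, minGenerators_eq_finrank_of_free (Q := Fin n → T),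
          Module.finrank_fin_fun]
    _ ≤ minGenerators T ((I × (Fin n → T)) ⧸ W) :=
        minGenerators_le_of_ker_le_smul (R := T) W.mkQ W.mkQ_surjective W.ker_mkQ.le
    _ ≤ minGenerators T K + minGenerators T ((_ ⧸ W) ⧸ K) := minGenerators_le_add K
    _ ≤ _ := add_le_add h1 h2

theorem height_eq_spanFinrank_of_isArtinianRing [IsRegularLocalRing T] [Nontrivial B]
    [IsArtinianRing B] {f : T →+* B} (hf : Function.Surjective f) :
    (RingHom.ker f).height = (maximalIdeal T).spanFinrank := by
  have hle : RingHom.ker f ≤ maximalIdeal T := le_maximalIdeal (RingHom.ker_ne_top f)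
  have : IsArtinianRing (T ⧸ RingHom.ker f) :=
    (RingHom.quotientKerEquivOfSurjective hf).symm.isArtinianRing
  have h : ((maximalIdeal T).height : WithBot ℕ∞) = (maximalIdeal T).spanFinrank := by
    rw [maximalIdeal_height_eq_ringKrullDim, IsRegularLocalRing.spanFinrank_maximalIdeal]
  have h' : (maximalIdeal T).height = (maximalIdeal T).spanFinrank := WithBot.coe_injective h
  refine le_antisymm (h' ▸ Ideal.height_mono hle) ?_
  rw [← h', Ideal.height_eq_inf_minimalPrimes (RingHom.ker f)]
  refine le_iInf₂ fun P hP ↦ ?_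
  have := hP.1.1
  have : IsArtinianRing (T ⧸ P) := (Ideal.Quotient.factor_surjective hP.1.2).isArtinianRing
  have : P = maximalIdeal T := eq_maximalIdeal
    (Ideal.Quotient.maximal_of_isField _ (IsArtinianRing.isField_of_isDomain _))
  rw [this]

end Presentation

/-! ### Coefficient fields -/

section CoefficientField

open IsLocalRing Polynomial

/-- A square-zero thickening of a field of characteristic `p` has a section. A maximal subring that
contains all `p`-th powers and meets the kernel trivially is the image of a section: it is
isomorphic to a subfield `L` of `K`, and if `b` lifts an element `k` of `K` outside `L`,
then `b ^ p` lies in the subring, so that the irreducibility of `X ^ p - k ^ p` over `L` allows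
adjoining `b`. -/
theorem exists_section_of_ker_sq_eq_bot (p : ℕ) [Fact p.Prime] {D K : Type*} [CommRing D] [Field K]
    [CharP D p] [CharP K p] (π : D →+* K) (hπ : Function.Surjective π)
    (hsq : RingHom.ker π ^ 2 = ⊥) : ∃ s : K →+* D, π.comp s = RingHom.id K := by
  have hp : p.Prime := Fact.out
  let P : Set (Subring D) := {F | (∀ d, d ^ p ∈ F) ∧ ∀ x ∈ F, π x = 0 → x = 0}
  have hP0 : (frobenius D p).range ∈ P := by
    refine ⟨fun d ↦ ⟨d, rfl⟩, ?_⟩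
    rintro _ ⟨d, rfl⟩ hd
    rw [frobenius_def, map_pow] at hd
    have hd' : d ∈ RingHom.ker π := eq_zero_of_pow_eq_zero hd
    have h2 : d ^ 2 ∈ RingHom.ker π ^ 2 := Ideal.pow_mem_pow hd' 2
    rw [hsq, Ideal.mem_bot] at h2
    exact pow_eq_zero_of_le hp.two_le h2
  obtain ⟨F, -, hF⟩ := zorn_le_nonempty₀ P (by
    intro c hc hchain y hy
    refine ⟨sSup c, ⟨fun d ↦ (le_sSup hy : y ≤ sSup c) ((hc hy).1 d), fun x hx hx0 ↦ ?_⟩,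
      fun z hz ↦ le_sSup hz⟩
    obtain ⟨z, hz, hxz⟩ := (Subring.mem_sSup_of_directedOn ⟨y, hy⟩ hchain.directedOn).1 hx
    exact (hc hz).2 x hxz hx0) _ hP0
  have hFpow := hF.prop.1
  have hFker := hF.prop.2
  -- the image of the subring is a subfield
  let L : Subfield K :=
    { F.map π with
      inv_mem' := by
        rintro _ ⟨y, hy, rfl⟩
        by_cases h0 : π y = 0
        · rw [h0, inv_zero]
          exact zero_mem (F.map π)
        · obtain ⟨d, hd⟩ := hπ (π y)⁻¹
          refine ⟨y ^ (p - 1) * d ^ p, mul_mem (pow_mem hy _) (hFpow d), ?_⟩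
          rw [map_mul, map_pow, map_pow, hd, inv_pow, ← pow_sub_one_mul hp.ne_zero (π y), mul_inv,
            ← mul_assoc, mul_inv_cancel₀ (pow_ne_zero _ h0), one_mul] }
  have hL (x : K) : x ∈ L ↔ ∃ y ∈ F, π y = x := Iff.rfl
  let e : F →+* L := (π.comp F.subtype).codRestrict L fun y ↦ ⟨y, y.2, rfl⟩
  have he : Function.Injective e := (injective_iff_map_eq_zero e).2 fun y hy ↦
    Subtype.ext (hFker y y.2 (congrArg Subtype.val hy))
  have hsurj : ∀ k, ∃ y ∈ F, π y = k := by
    by_contra! hcon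
    obtain ⟨k, hk⟩ := hcon
    obtain ⟨b, hb⟩ := hπ k
    have hkL : k ∉ L := fun h ↦ by
      obtain ⟨y, hy, h⟩ := (hL k).1 h
      exact hk y hy h
    let c : F := ⟨b ^ p, hFpow b⟩
    have hirr : Irreducible (X ^ p - C (e c)) := by
      refine X_pow_sub_C_irreducible_of_prime hp fun y hy ↦ hkL ?_
      have h1 : (y : K) ^ p = k ^ p := by
        rw [← hb, ← map_pow]
        exact congrArg Subtype.val hy
      rw [← frobenius_inj K p h1]
      exact y.2
    have hmin : X ^ p - C (e c) = minpoly L k := by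
      refine minpoly.eq_of_irreducible_of_monic hirr ?_ (monic_X_pow_sub_C _ hp.ne_zero)
      have : algebraMap L K (e c) = k ^ p := by
        rw [← hb, ← map_pow]
        rfl
      simp [this]
    have hmon : (X ^ p - C c).Monic := monic_X_pow_sub_C _ hp.ne_zero
    have hcomp : (algebraMap L K).comp e = π.comp F.subtype := rfl
    have hmem : (eval₂RingHom F.subtype b).range ∈ P := by
      refine ⟨fun d ↦ ⟨C ⟨d ^ p, hFpow d⟩, by simp⟩, ?_⟩
      rintro _ ⟨q, rfl⟩ hq
      rw [coe_eval₂RingHom] at hq ⊢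
      have hroot : eval₂ F.subtype b (X ^ p - C c) = 0 := by simp [c]
      have hmod : eval₂ F.subtype b (q %ₘ (X ^ p - C c)) = eval₂ F.subtype b q := by
        conv_rhs => rw [← modByMonic_add_div q (X ^ p - C c), eval₂_add, eval₂_mul, hroot,
          zero_mul, add_zero]
      rw [← hmod, hom_eval₂, hb, ← hcomp, ← eval₂_map] at hq
      suffices h0 : (q %ₘ (X ^ p - C c)).map e = 0 by
        rw [Polynomial.map_eq_zero_iff he] at h0
        rw [← hmod, h0, eval₂_zero]
      by_contra hne
      have h1 := minpoly.degree_le_of_ne_zero L k hne hq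
      have : Nontrivial F := ⟨0, 1, fun h ↦ zero_ne_one (α := K) (by
        simpa using congrArg (fun y : F ↦ π y) h)⟩
      have h2 := degree_modByMonic_lt q hmon
      rw [degree_X_pow_sub_C hp.pos] at h2
      rw [← hmin, degree_X_pow_sub_C hp.pos, degree_map_eq_of_injective he] at h1
      exact absurd h2 (not_lt.2 h1)
    have hle : F ≤ (eval₂RingHom F.subtype b).range := fun y hy ↦ ⟨C ⟨y, hy⟩, by simp⟩
    exact hk b (hF.le_of_ge hmem hle ⟨X, by simp⟩) hb
  let ε : F ≃+* K := RingEquiv.ofBijective (π.comp F.subtype)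
    ⟨fun y z h ↦ he (Subtype.ext h), fun k ↦ by
      obtain ⟨y, hy, h⟩ := hsurj k
      exact ⟨⟨y, hy⟩, h⟩⟩
  exact ⟨F.subtype.comp ε.symm.toRingHom, RingHom.ext fun k ↦ ε.apply_symm_apply k⟩

/-- Every extension field of `𝔽_p` is formally smooth over `𝔽_p`. -/
theorem formallySmooth_zmod (p : ℕ) [Fact p.Prime] (K : Type*) [Field K] [Algebra (ZMod p) K] :
    Algebra.FormallySmooth (ZMod p) K := by
  refine Algebra.FormallySmooth.of_comp_surjective fun B _ _ I hI f ↦ ?_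
  -- the pullback of `B → B ⧸ I` along `f`
  let D : Subring (B × K) :=
    RingHom.eqLocus ((Ideal.Quotient.mk I).comp (RingHom.fst B K))
      ((f : K →+* B ⧸ I).comp (RingHom.snd B K))
  let π : D →+* K := (RingHom.snd B K).comp D.subtype
  have hπ : Function.Surjective π := fun k ↦ by
    obtain ⟨b, hb⟩ := Ideal.Quotient.mk_surjective (f k)
    exact ⟨⟨(b, k), hb⟩, rfl⟩
  have hK : CharP K p := charP_of_injective_algebraMap (algebraMap (ZMod p) K).injective p
  have hp0 : ((p : ℕ) : D) = 0 := by
    refine Subtype.ext (Prod.ext ?_ ?_)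
    · have : ((p : ℕ) : B) = 0 := by
        rw [← map_natCast (algebraMap (ZMod p) B), ZMod.natCast_self, map_zero]
      simpa using this
    · simp
  have : Nontrivial D := π.domain_nontrivial
  have hD : CharP D p := (CharP.charP_iff_prime_eq_zero Fact.out).2 hp0
  have hsq : RingHom.ker π ^ 2 = ⊥ := by
    rw [eq_bot_iff, pow_two, Ideal.mul_le]
    intro x hx y hy
    have hmem (z : D) (hz : z ∈ RingHom.ker π) : z.1.1 ∈ I := by
      have h1 : Ideal.Quotient.mk I z.1.1 = f z.1.2 := z.2
      have h2 : z.1.2 = 0 := hz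
      rwa [h2, map_zero, Ideal.Quotient.eq_zero_iff_mem] at h1
    have h3 : x.1.1 * y.1.1 ∈ I ^ 2 := by
      rw [pow_two]
      exact Ideal.mul_mem_mul (hmem x hx) (hmem y hy)
    rw [hI, Ideal.mem_bot] at h3
    have hx2 : x.1.2 = 0 := hx
    exact Subtype.ext (Prod.ext h3 (by simp [hx2]))
  obtain ⟨s, hs⟩ := exists_section_of_ker_sq_eq_bot p π hπ hsq
  let g : K →+* B := ((RingHom.fst B K).comp D.subtype).comp s
  refine ⟨{ g with commutes' := fun r ↦
    RingHom.congr_fun (Subsingleton.elim (g.comp (algebraMap (ZMod p) K)) (algebraMap _ B)) r }, ?_⟩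
  refine AlgHom.ext fun k ↦ ?_
  have h1 : Ideal.Quotient.mk I (s k).1.1 = f (s k).1.2 := (s k).2
  have h2 : (s k).1.2 = k := RingHom.congr_fun hs k
  rw [h2] at h1
  exact h1

theorem formallySmooth_rat (K : Type*) [Field K] [Algebra ℚ K] :
    Algebra.FormallySmooth ℚ K := by
  obtain ⟨s, hs⟩ := exists_isTranscendenceBasis ℚ K
  have : Algebra.IsAlgebraic (IntermediateField.adjoin ℚ (Set.range ((↑) : s → K))) K :=
    hs.isAlgebraic_field
  exact .of_algebraicIndependent_of_isSeparable hs.1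

variable {A : Type*} [CommRing A] [IsLocalRing A] [IsArtinianRing A]

theorem exists_section_of_formallySmooth (k : Type*) [CommRing k] [Algebra k A]
    [Algebra.FormallySmooth k (ResidueField A)] :
    ∃ s : ResidueField A →+* A, (residue A).comp s = RingHom.id _ := by
  let π : A →ₐ[k] ResidueField A := IsScalarTower.toAlgHom k A (ResidueField A)
  have hker : RingHom.ker (π : A →+* ResidueField A) = maximalIdeal A := ker_residue
  have hnil : IsNilpotent (RingHom.ker (π : A →+* ResidueField A)) := by
    rw [hker, ← IsLocalRing.jacobson_eq_maximalIdeal (⊥ : Ideal A) bot_ne_top]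
    exact IsArtinianRing.isNilpotent_jacobson_bot
  let s := Algebra.FormallySmooth.liftOfSurjective (AlgHom.id k (ResidueField A)) π
    residue_surjective hnil
  exact ⟨s, RingHom.ext fun x ↦ Algebra.FormallySmooth.liftOfSurjective_apply
    (AlgHom.id k (ResidueField A)) π residue_surjective hnil x⟩

/-- An equicharacteristic Artinian local ring contains a coefficient field. -/
theorem exists_coefficientField (hA : ringChar A = ringChar (ResidueField A)) :
    ∃ s : ResidueField A →+* A, (residue A).comp s = RingHom.id _ := by
  rcases CharP.char_is_prime_or_zero (ResidueField A) (ringChar (ResidueField A)) with hp | h0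
  · have : Fact (ringChar (ResidueField A)).Prime := ⟨hp⟩
    have : CharP A (ringChar (ResidueField A)) := hA ▸ ringChar.charP A
    let := ZMod.algebra A (ringChar (ResidueField A))
    have := formallySmooth_zmod (ringChar (ResidueField A)) (ResidueField A)
    exact exists_section_of_formallySmooth (ZMod (ringChar (ResidueField A)))
  · have : CharZero (ResidueField A) := by
      have := ringChar.charP (ResidueField A)
      rw [h0] at this
      exact CharP.charP_to_charZero _
    obtain ⟨_⟩ : Nonempty (Algebra ℚ A) :=
        (EqualCharZero.nonempty_algebraRat_iff A).2 fun I hI ↦ by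
      have hle : I ≤ RingHom.ker (residue A) := by
        rw [ker_residue]
        exact le_maximalIdeal hI
      exact RingHom.charZero (Ideal.Quotient.lift I (residue A) hle)
    have := @formallySmooth_rat (ResidueField A) _ (ResidueField.algebra A)
    exact exists_section_of_formallySmooth ℚ

/-- A coefficient field and generators of the maximal ideal generate an Artinian local ring. -/
theorem eval₂Hom_surjective {r : ℕ} {s : ResidueField A →+* A}
    (hs : (residue A).comp s = RingHom.id _) {a : Fin r → A}
    (ha : Ideal.span (Set.range a) = maximalIdeal A) :
    Function.Surjective (MvPolynomial.eval₂Hom s a) := by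
  have key (i : ℕ) : ∀ y : A, ∃ q, y - MvPolynomial.eval₂Hom s a q ∈ maximalIdeal A ^ i := by
    induction i with
    | zero => exact fun y ↦ ⟨0, by simp⟩
    | succ i ih =>
      intro y
      have hy : y - s (residue A y) ∈ maximalIdeal A := by
        rw [← ker_residue, RingHom.mem_ker, map_sub, sub_eq_zero]
        exact (RingHom.congr_fun hs _).symm
      rw [← ha] at hy
      obtain ⟨c, hc⟩ := Ideal.mem_span_range_iff_exists_fun.1 hy
      choose q hq using fun j ↦ ih (c j)
      refine ⟨MvPolynomial.C (residue A y) + ∑ j, q j * MvPolynomial.X j, ?_⟩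
      have : y - MvPolynomial.eval₂Hom s a
          (MvPolynomial.C (residue A y) + ∑ j, q j * MvPolynomial.X j) =
          ∑ j, (c j - MvPolynomial.eval₂Hom s a (q j)) * a j := by
        simp only [map_add, map_sum, map_mul, MvPolynomial.eval₂Hom_C, MvPolynomial.eval₂Hom_X',
          sub_mul, Finset.sum_sub_distrib, hc]
        ring
      rw [this, pow_succ]
      exact sum_mem fun j _ ↦ Ideal.mul_mem_mul (hq j) (ha ▸ Ideal.subset_span ⟨j, rfl⟩)
  have hnil : IsNilpotent (maximalIdeal A) := by
    rw [← IsLocalRing.jacobson_eq_maximalIdeal (⊥ : Ideal A) bot_ne_top]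
    exact IsArtinianRing.isNilpotent_jacobson_bot
  obtain ⟨N, hN⟩ := hnil
  intro y
  obtain ⟨q, hq⟩ := key N y
  rw [hN] at hq
  exact ⟨q, (sub_eq_zero.1 hq).symm⟩

/-- Cohen's structure theorem for equicharacteristic Artinian local rings: such a ring is a quotient
of a polynomial ring over its residue field, localized at a maximal ideal. -/
theorem exists_presentation.{u} {A : Type u} [CommRing A] [IsLocalRing A] [IsArtinianRing A]
    (hA : ringChar A = ringChar (ResidueField A)) :
    ∃ (T : Type u) (_ : CommRing T) (f : T →+* A),
      IsRegularLocalRing T ∧ Function.Surjective f := by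
  obtain ⟨s, hs⟩ := exists_coefficientField hA
  obtain ⟨a, ha⟩ := exists_span_range_eq_maximalIdeal (T := A)
  set φ := MvPolynomial.eval₂Hom s a
  have hφ : Function.Surjective φ := eval₂Hom_surjective hs ha
  set P := (maximalIdeal A).comap φ
  have hP : P.IsPrime := inferInstance
  have hunit (y : P.primeCompl) : IsUnit (φ y) := by
    by_contra h
    exact y.2 ((mem_maximalIdeal _).2 h)
  refine ⟨Localization.AtPrime P, inferInstance, IsLocalization.lift hunit, inferInstance,
    fun y ↦ ?_⟩
  obtain ⟨q, rfl⟩ := hφ y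
  exact ⟨algebraMap _ _ q, IsLocalization.lift_eq hunit q⟩

end CoefficientField

/-! ### The complete intersection defect -/

section Cid

open IsLocalRing

universe u

theorem exists_isCid {T B : Type u} [CommRing T] [CommRing B] [IsRegularLocalRing T]
    [Nontrivial B] [IsArtinianRing B] {f : T →+* B} (hf : Function.Surjective f) :
    ∃ c, IsCid B c := by
  have h1 := Ideal.height_le_spanFinrank (RingHom.ker f) (RingHom.ker_ne_top f)
  rw [height_eq_spanFinrank_of_isArtinianRing hf, Nat.cast_le] at h1
  refine ⟨minGenerators T (RingHom.ker f) - (maximalIdeal T).spanFinrank, T, inferInstance, f,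
    inferInstance, hf, ?_⟩
  rw [height_eq_spanFinrank_of_isArtinianRing hf, minGenerators, Submodule.spanFinrank_top,
    ← Nat.cast_add, Nat.add_sub_cancel' h1]

/-- The complete intersection defect of an Artinian local ring can be computed from any
presentation. -/
theorem minGenerators_ker_eq_add_cid {T B : Type u} [CommRing T] [CommRing B]
    [IsRegularLocalRing T] [Nontrivial B] [IsArtinianRing B] {f : T →+* B}
    (hf : Function.Surjective f) :
    minGenerators T (RingHom.ker f) = (maximalIdeal T).spanFinrank + cid B := by
  obtain ⟨T', _, g, hT', hg, h⟩ : IsCid B (cid B) := Nat.sInf_mem (exists_isCid hf)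
  rw [height_eq_spanFinrank_of_isArtinianRing hg, ← Nat.cast_add, Nat.cast_inj] at h
  have := minGenerators_ker_add_spanFinrank hf hg
  omega

end Cid

theorem corollary20 {A : Type*} [CommRing A] [IsLocalRing A] [IsArtinianRing A]
    (hA : ringChar A = ringChar (IsLocalRing.ResidueField A))
    (n : ℕ) (x : Fin n → A) (hx : ∀ i, x i ∈ IsLocalRing.maximalIdeal A)
    (hcid : cid (A ⧸ Ideal.span (Set.range x)) ≤ cid A) :
    n ≤ minGenerators A (Koszul.homology x 1) := by
  obtain ⟨T, _, f, hT, hf⟩ := exists_presentation hA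
  obtain ⟨x, rfl⟩ := hf.comp_left x
  have hloc : IsLocalHom f := hf.isLocalHom
  have hxT (i : Fin n) : x i ∈ IsLocalRing.maximalIdeal T := fun h ↦ hx i (h.map f)
  set J := Ideal.span (Set.range (f ∘ x))
  have hJ : J ≤ IsLocalRing.maximalIdeal A := by
    rw [Ideal.span_le]
    rintro _ ⟨i, rfl⟩
    exact hx i
  have : IsLocalRing (A ⧸ J) := isLocalRing_quotient hJ
  have hg : Function.Surjective ((Ideal.Quotient.mk J).comp f) :=
    Ideal.Quotient.mk_surjective.comp hf
  have hker : RingHom.ker ((Ideal.Quotient.mk J).comp f) =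
      RingHom.ker f ⊔ Ideal.span (Set.range x) := by
    rw [← RingHom.comap_ker, Ideal.mk_ker, sup_comm, ← Ideal.comap_map_of_surjective' f hf,
      Ideal.map_span, ← Set.range_comp]
  have h1 := minGenerators_ker_eq_add_cid hf
  have h2 := minGenerators_ker_eq_add_cid hg
  rw [hker] at h2
  have h3 := minGenerators_ker_add_le hf x hxT
  have h4 := minGenerators_syzygyHomology_le (f ∘ x)
  change n ≤ minGenerators A (Koszul.homology (f ∘ x) 1)
  omega
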